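/- Let $d\ge 1$ and $N\ge 2$ be integers and let $\varphi:(0,+\infty)\to[0,+\infty)$ be continuous and strictly decreasing with $\lim_{t\to0^+}\varphi(t)=+\infty$. For $x_1,\dots,x_N\in\mathbb R^d$ put $$c(x_1,\dots,x_N)=\sum_{1\le i<j\le N}\varphi(|x_i-x_j|),\qquad \varphi(0):=+\infty .$$ Let $\rho$ be a Borel probability measure on $\mathbb R^d$, let $\mu_\rho(r)=\sup_{x\in\mathbb R^d}\rho(B(x,r))$, where $B(x,r)$ is the open ball, and assume $$\textbf{(A)}\qquad \lim_{r\to0^+}\mu_\rho(r)<\frac1{N(N-1)^2}.$$ Let $u:\mathbb R^d\to\mathbb R$ be a Kantorovich potential, that is, a maximizer of $N\int v\,d\rho$ among all $\rho$-integrable functions $v:\mathbb R^d\to\mathbb R$ such that $v(x_1)+\dots+v(x_N)\le c(x_1,\dots,x_N)$ for all $x_1,\dots,x_N\in\mathbb R^d$, and suppose that $$u(x)=\inf\Big\{c(x,y_2,\dots,y_N)-\sum_{j=2}^N u(y_j)\ :\ y_2,\dots,y_N\in\mathbb R^d\Big\}\qquad\text{for all }x\in\mathbb R^d.$$ Then,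 for every $\beta>0$ with $\mu_\rho(\beta)<\frac1{N(N-1)^2}$ and every $\alpha$ with $0<\alpha<\varphi^{-1}\big(\frac{N^2(N-1)}2\varphi(\beta)\big)$, the function $u$ is bounded and $$\sup_{\mathbb R^d}|u|\le N(N-1)^2\,\varphi\Big(\frac\alpha2\Big).$$ -/

import Mathlib

open MeasureTheory Filter Topology

namespace RepulsiveOT

noncomputable section

/-- The standing assumptions on the interaction `φ : (0, ∞) → [0, ∞)`. Only the values of `φ` on
`(0, ∞)` are ever used. -/
structure IsRepulsive (φ : ℝ → ℝ) : Prop where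
  continuousOn : ContinuousOn φ (Set.Ioi 0)
  nonneg : ∀ t : ℝ, 0 < t → 0 ≤ φ t
  tendsto_zero : Tendsto φ (𝓝[>] 0) atTop
  strictAntiOn : StrictAntiOn φ (Set.Ioi 0)

/-- `φ` extended to distance zero by its limit `+∞`. -/
def extend (φ : ℝ → ℝ) (t : ℝ) : EReal := if 0 < t then (φ t : EReal) else ⊤

/-- The cost `c(x₁, …, xₙ) = ∑_{i < j} φ(|xᵢ - xⱼ|)`; it is `+∞` as soon as two of the points
coincide. -/
def cost (φ : ℝ → ℝ) {d n : ℕ} (x : Fin n → EuclideanSpace ℝ (Fin d)) : EReal :=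
  ∑ i : Fin n, ∑ j ∈ Finset.Ioi i, extend φ (dist (x i) (x j))

/-- The concentration `μ_ρ(r) = sup_x ρ(B(x, r))` of `ρ` at scale `r` (open balls). -/
def concentration {d : ℕ} (ρ : Measure (EuclideanSpace ℝ (Fin d))) (r : ℝ) : ℝ :=
  ⨆ x : EuclideanSpace ℝ (Fin d), ρ.real (Metric.ball x r)

/-- Assumption (A): `lim_{r → 0⁺} μ_ρ(r) < 1 / (N (N - 1)²)`. -/
def SmallConcentration (N : ℕ) {d : ℕ} (ρ : Measure (EuclideanSpace ℝ (Fin d))) : Prop :=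
  ∃ l : ℝ, Tendsto (concentration ρ) (𝓝[>] 0) (𝓝 l) ∧ l < 1 / ((N : ℝ) * ((N : ℝ) - 1) ^ 2)

/-- The admissible functions of the dual problem: `ρ`-integrable `u` with
`u(x₁) + ⋯ + u(x_N) ≤ c(x₁, …, x_N)` everywhere. -/
def dualAdmissible (φ : ℝ → ℝ) (N : ℕ) {d : ℕ} (ρ : Measure (EuclideanSpace ℝ (Fin d))) :
    Set (EuclideanSpace ℝ (Fin d) → ℝ) :=
  {u | Integrable u ρ ∧
    ∀ x : Fin N → EuclideanSpace ℝ (Fin d), ((∑ i, u (x i) : ℝ) : EReal) ≤ cost φ x}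

/-- A Kantorovich potential: a maximizer of `N ∫ u dρ` among the admissible functions. -/
def IsKantorovichPotential (φ : ℝ → ℝ) (N : ℕ) {d : ℕ}
    (ρ : Measure (EuclideanSpace ℝ (Fin d))) (u : EuclideanSpace ℝ (Fin d) → ℝ) : Prop :=
  u ∈ dualAdmissible φ N ρ ∧
    IsMaxOn (fun v : EuclideanSpace ℝ (Fin d) → ℝ => (N : ℝ) * ∫ x, v x ∂ρ)
      (dualAdmissible φ N ρ) u

/-- The `c`-conjugate `x ↦ inf {c(x, y₂, …, y_N) - ∑_{j ≥ 2} u(y_j)}`, with values in `[-∞, ∞]`;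
used for `N ≥ 1` only, the points `y₂, …, y_N` being indexed by `Fin (N - 1)`. -/
def cConjugate (φ : ℝ → ℝ) (N : ℕ) {d : ℕ} (u : EuclideanSpace ℝ (Fin d) → ℝ)
    (x : EuclideanSpace ℝ (Fin d)) : EReal :=
  ⨅ y : Fin (N - 1) → EuclideanSpace ℝ (Fin d),
    cost φ (Fin.cons x y : Fin (N - 1 + 1) → EuclideanSpace ℝ (Fin d)) -
      ((∑ j, u (y j) : ℝ) : EReal)

/-- The inverse `φ⁻¹` of `φ : (0, ∞) → ℝ` on its range. -/
def inverse (φ : ℝ → ℝ) (s : ℝ) : ℝ := Function.invFunOn φ (Set.Ioi 0) s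

end

end RepulsiveOT

/-!
Let `K x y = φ(|x - y|)`. As the ball `B(x, β)` has mass less than `1 / N`, there is an almost tight
configuration `z` with no point in it: otherwise lowering `u` on the ball and raising it everywhere
by a smaller amount would increase `∫ u dρ`. Since `∑ u(zᵢ) ≤ c(z) ≤ ∑ₖ ∑_{i ≠ k} K zₖ zᵢ`, some `k`
satisfies `u(zₖ) ≤ ∑_{i ≠ k} K zₖ zᵢ`. Moving `zₖ` to `x` and testing the constraint on the new
configuration gives `u(x) ≤ ∑_{i ≠ k} K x zᵢ ≤ (N - 1) φ(β)` up to an arbitrarily small error.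
Inserting this upper bound into the conjugate formula gives `u ≥ -(N - 1)² φ(β)`.

The argument is carried out for a symmetric `K ≥ 0` on a measurable space, with the superlevel set
`{y | M < K x y}` in place of the ball `B(x, β)` and `M` in place of `φ(β)`.
-/

namespace RepulsiveOT

section EReal

variable {ι : Type*}

lemma coe_sum_eq_sum_coe (s : Finset ι) (f : ι → ℝ) :
    ((∑ i ∈ s, f i : ℝ) : EReal) = ∑ i ∈ s, (f i : EReal) :=
  map_sum (⟨⟨Real.toEReal, EReal.coe_zero⟩, EReal.coe_add⟩ : ℝ →+ EReal) f s

lemma exists_coe_le_of_coe_sum_le [Fintype ι] [Nonempty ι] {r : ι → ℝ} {e : ι → EReal}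
    (h : ((∑ k, r k : ℝ) : EReal) ≤ ∑ k, e k) : ∃ k, (r k : EReal) ≤ e k := by
  by_contra! hlt
  choose q heq hqr using fun k => EReal.lt_iff_exists_real_btwn.1 (hlt k)
  have hrq : ((∑ k, r k : ℝ) : EReal) ≤ ((∑ k, q k : ℝ) : EReal) :=
    h.trans <| (Finset.sum_le_sum fun k _ => (heq k).le).trans_eq (coe_sum_eq_sum_coe _ q).symm
  have hqr_sum : ∑ k, q k < ∑ k, r k :=
    Finset.sum_lt_sum_of_nonempty Finset.univ_nonempty fun k _ => EReal.coe_lt_coe_iff.1 (hqr k)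
  exact hqr_sum.not_ge (EReal.coe_le_coe_iff.1 hrq)

end EReal

section Duality

variable {X ι : Type*} [Fintype ι]

lemma sum_add_const_sub_indicator_le [Nonempty ι] (u : X → ℝ) {B : Set X} {δ : ℝ} (hδ : 0 ≤ δ)
    {x : ι → X} {k : ι} (hk : x k ∈ B) :
    ∑ i, (u (x i) + δ / Fintype.card ι - B.indicator (fun _ => δ) (x i)) ≤ ∑ i, u (x i) := by
  have hδk : δ ≤ ∑ i, B.indicator (fun _ => δ) (x i) :=
    (Set.indicator_of_mem hk _).ge.trans <|
      Finset.single_le_sum (f := fun i => B.indicator (fun _ => δ) (x i))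
        (fun i _ => Set.indicator_nonneg (fun _ _ => hδ) _) (Finset.mem_univ k)
  have hcard : (Fintype.card ι : ℝ) ≠ 0 := Nat.cast_ne_zero.2 Fintype.card_ne_zero
  simp only [Finset.sum_sub_distrib, Finset.sum_add_distrib, Finset.sum_const, Finset.card_univ,
    nsmul_eq_mul, mul_div_cancel₀ _ hcard]
  linarith

variable [MeasurableSpace X] {c : (ι → X) → EReal} {ρ : Measure X} {u : X → ℝ}

/-- The admissible functions of the dual problem with equal marginals `ρ` for an arbitrary cost `c`
of the points `(xᵢ)` indexed by `ι`; `dualAdmissible` is the case `c = cost φ`. -/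
def dualFeasible (c : (ι → X) → EReal) (ρ : Measure X) : Set (X → ℝ) :=
  {u | Integrable u ρ ∧ ∀ x : ι → X, ((∑ i, u (x i) : ℝ) : EReal) ≤ c x}

/-- A maximizer of the dual problem for an arbitrary cost. The factor `card ι` in front of the
integral is dropped. -/
def IsDualMaximizer (c : (ι → X) → EReal) (ρ : Measure X) (u : X → ℝ) : Prop :=
  u ∈ dualFeasible c ρ ∧ IsMaxOn (fun v : X → ℝ => ∫ x, v x ∂ρ) (dualFeasible c ρ) u

lemma add_const_sub_indicator_mem_dualFeasible [Nonempty ι] [IsFiniteMeasure ρ]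
    (hu : u ∈ dualFeasible c ρ) {B : Set X} (hB : MeasurableSet B) {δ : ℝ} (hδ : 0 ≤ δ)
    (hslack : ∀ x : ι → X, (∀ i, x i ∉ B) → ((∑ i, u (x i) + δ : ℝ) : EReal) ≤ c x) :
    (fun x => u x + δ / Fintype.card ι - B.indicator (fun _ => δ) x) ∈ dualFeasible c ρ := by
  refine ⟨(hu.1.add (integrable_const _)).sub ((integrable_const δ).indicator hB), fun x => ?_⟩
  by_cases hx : ∀ i, x i ∉ B
  · refine le_of_eq_of_le (congrArg _ ?_) (hslack x hx)
    have hcard : (Fintype.card ι : ℝ) ≠ 0 := Nat.cast_ne_zero.2 Fintype.card_ne_zero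
    simp [Finset.sum_add_distrib, hx, mul_div_cancel₀ _ hcard]
  · obtain ⟨k, hk⟩ := not_forall_not.1 hx
    exact (EReal.coe_le_coe_iff.2 (sum_add_const_sub_indicator_le u hδ hk)).trans (hu.2 x)

lemma integral_add_const_sub_indicator [IsFiniteMeasure ρ] (hu : Integrable u ρ) {B : Set X}
    (hB : MeasurableSet B) (a b : ℝ) :
    ∫ x, (u x + a - B.indicator (fun _ => b) x) ∂ρ
      = ∫ x, u x ∂ρ + ρ.real Set.univ * a - ρ.real B * b := by
  have hua : Integrable (fun x => u x + a) ρ := hu.add (integrable_const _)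
  rw [integral_sub hua ((integrable_const b).indicator hB), integral_add hu (integrable_const _),
    integral_const, integral_indicator_const _ hB, smul_eq_mul, smul_eq_mul]

lemma IsDualMaximizer.exists_almost_tight [Nonempty ι] [IsFiniteMeasure ρ]
    (hu : IsDualMaximizer c ρ u) {B : Set X}
    (hρB : Fintype.card ι * ρ.real B < ρ.real Set.univ) {δ : ℝ} (hδ : 0 < δ) :
    ∃ z : ι → X, (∀ i, z i ∉ B) ∧ c z < ((∑ i, u (z i) + δ : ℝ) : EReal) := by
  by_contra! hslack
  have hB := measurableSet_toMeasurable ρ B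
  have hmax := hu.2 <| add_const_sub_indicator_mem_dualFeasible hu.1 hB hδ.le fun x hx =>
    hslack x fun i hi => hx i (subset_toMeasurable ρ B hi)
  have hcard : (0 : ℝ) < Fintype.card ι := Nat.cast_pos.2 Fintype.card_pos
  have hint := integral_add_const_sub_indicator hu.1.1 hB (δ / Fintype.card ι) δ
  rw [show ρ.real (toMeasurable ρ B) = ρ.real B from
    congrArg ENNReal.toReal (measure_toMeasurable B)] at hint
  have hgain : ρ.real B * δ < ρ.real Set.univ * (δ / Fintype.card ι) := by
    rw [← mul_div_assoc, lt_div_iff₀ hcard]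
    nlinarith
  have hle := hint.symm.trans_le hmax
  linarith

end Duality

section Conjugate

variable {X : Type*} {n : ℕ}

/-- The conjugate of `u` with respect to an arbitrary cost of `n + 1` points;
`cConjugate φ N` is the case `c = cost φ`, `n = N - 1`. -/
noncomputable def conjugate (c : (Fin (n + 1) → X) → EReal) (u : X → ℝ) (x : X) : EReal :=
  ⨅ y : Fin n → X, c (Fin.cons x y) - ((∑ j, u (y j) : ℝ) : EReal)

lemma neg_mul_le_conjugate {c : (Fin (n + 1) → X) → EReal} (hc : ∀ x, 0 ≤ c x) {u : X → ℝ} {M : ℝ}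
    (hM : ∀ x, u x ≤ M) (x : X) : ((-(n * M) : ℝ) : EReal) ≤ conjugate c u x := by
  refine le_iInf fun y => ?_
  have hsum : ∑ j, u (y j) ≤ n * M := by
    simpa using Finset.sum_le_card_nsmul Finset.univ (fun j => u (y j)) M fun j _ => hM (y j)
  calc ((-(n * M) : ℝ) : EReal) ≤ ((0 - ∑ j, u (y j) : ℝ) : EReal) :=
        EReal.coe_le_coe_iff.2 (by linarith)
    _ = 0 - ((∑ j, u (y j) : ℝ) : EReal) := by rw [EReal.coe_sub, EReal.coe_zero]
    _ ≤ _ := EReal.sub_le_sub (hc _) le_rfl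

end Conjugate

section PairCost

lemma sum_comp_update {X ι A : Type*} [Fintype ι] [DecidableEq ι] [AddCommMonoid A] (u : X → A)
    (z : ι → X) (k : ι) (x : X) :
    ∑ i, u (Function.update z k x i) = u x + ∑ i ∈ Finset.univ.erase k, u (z i) := by
  rw [← Finset.add_sum_erase _ _ (Finset.mem_univ k), Function.update_self]
  exact congrArg _ <| Finset.sum_congr rfl fun i hi => by
    rw [Function.update_of_ne (Finset.ne_of_mem_erase hi)]

variable {X ι : Type*} [Fintype ι] [LinearOrder ι] [LocallyFiniteOrderTop ι]

lemma sum_sum_Ioi_eq_sum_erase_add {A : Type*} [AddCommMonoid A] {f : ι → ι → A}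
    (hf : ∀ i j, f i j = f j i) (k : ι) :
    ∑ i, ∑ j ∈ Finset.Ioi i, f i j = ∑ i ∈ Finset.univ.erase k, f k i +
      ∑ i ∈ Finset.univ.erase k, ∑ j ∈ (Finset.Ioi i).erase k, f i j := by
  have hrow : ∀ i, ∑ j ∈ Finset.Ioi i, f i j
      = (if i < k then f k i else 0) + ∑ j ∈ (Finset.Ioi i).erase k, f i j := by
    intro i
    split_ifs with hik
    · rw [hf k i, Finset.add_sum_erase _ _ (Finset.mem_Ioi.2 hik)]
    · rw [zero_add, Finset.erase_eq_of_notMem (by simpa using hik)]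
  have habove : (Finset.univ.erase k).filter (¬ · < k) = Finset.Ioi k := by grind
  calc ∑ i, ∑ j ∈ Finset.Ioi i, f i j
      = ∑ j ∈ Finset.Ioi k, f k j + ∑ i ∈ Finset.univ.erase k, ∑ j ∈ Finset.Ioi i, f i j :=
        (Finset.add_sum_erase _ _ (Finset.mem_univ k)).symm
    _ = ∑ j ∈ Finset.Ioi k, f k j + ∑ i ∈ (Finset.univ.erase k).filter (· < k), f k i +
          ∑ i ∈ Finset.univ.erase k, ∑ j ∈ (Finset.Ioi i).erase k, f i j := by
        rw [Finset.sum_congr rfl fun i _ => hrow i, Finset.sum_add_distrib, Finset.sum_filter,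
          add_assoc]
    _ = _ := by
        rw [← Finset.sum_filter_add_sum_filter_not (Finset.univ.erase k) (· < k) (f k),
          habove, add_comm (∑ j ∈ Finset.Ioi k, f k j)]

variable {K : X → X → EReal}

/-- The cost given by a symmetric two-point interaction `K`; `cost φ` is the case
`K x y = extend φ (dist x y)`. -/
noncomputable def pairCost (K : X → X → EReal) (x : ι → X) : EReal :=
  ∑ i, ∑ j ∈ Finset.Ioi i, K (x i) (x j)

lemma pairCost_nonneg (hK : ∀ x y, 0 ≤ K x y) (x : ι → X) : 0 ≤ pairCost K x :=
  Finset.sum_nonneg fun _ _ => Finset.sum_nonneg fun _ _ => hK _ _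

lemma pairCost_le_sum_sum_erase (hK : ∀ x y, 0 ≤ K x y) (x : ι → X) :
    pairCost K x ≤ ∑ k, ∑ i ∈ Finset.univ.erase k, K (x k) (x i) :=
  Finset.sum_le_sum fun _ _ => Finset.sum_le_sum_of_subset_of_nonneg
    (fun j hj => Finset.mem_erase.2 ⟨(Finset.mem_Ioi.1 hj).ne', Finset.mem_univ j⟩)
    fun _ _ _ => hK _ _

/-- The pair cost of the points of `x` other than `x k`. -/
noncomputable def pairCostErase (K : X → X → EReal) (x : ι → X) (k : ι) : EReal :=
  ∑ i ∈ Finset.univ.erase k, ∑ j ∈ (Finset.Ioi i).erase k, K (x i) (x j)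

lemma pairCostErase_nonneg (hK : ∀ x y, 0 ≤ K x y) (x : ι → X) (k : ι) : 0 ≤ pairCostErase K x k :=
  Finset.sum_nonneg fun _ _ => Finset.sum_nonneg fun _ _ => hK _ _

lemma pairCost_eq_sum_erase_add (hsymm : ∀ x y, K x y = K y x) (x : ι → X) (k : ι) :
    pairCost K x = ∑ i ∈ Finset.univ.erase k, K (x k) (x i) + pairCostErase K x k :=
  sum_sum_Ioi_eq_sum_erase_add (fun _ _ => hsymm _ _) k

lemma pairCost_update (hsymm : ∀ x y, K x y = K y x) (z : ι → X) (k : ι) (x : X) :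
    pairCost K (Function.update z k x)
      = ∑ i ∈ Finset.univ.erase k, K x (z i) + pairCostErase K z k := by
  rw [pairCost_eq_sum_erase_add hsymm _ k]
  congr 1
  · refine Finset.sum_congr rfl fun i hi => ?_
    rw [Function.update_self, Function.update_of_ne (Finset.ne_of_mem_erase hi)]
  · refine Finset.sum_congr rfl fun i hi => Finset.sum_congr rfl fun j hj => ?_
    rw [Function.update_of_ne (Finset.ne_of_mem_erase hi),
      Function.update_of_ne (Finset.ne_of_mem_erase hj)]

lemma pairCost_update_le [Nonempty ι] (hsymm : ∀ x y, K x y = K y x) {z : ι → X} {x : X} {M : ℝ}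
    (hM : ∀ i, K x (z i) ≤ M) (k : ι) :
    pairCost K (Function.update z k x)
      ≤ (((Fintype.card ι - 1) * M : ℝ) : EReal) + pairCostErase K z k := by
  refine (pairCost_update hsymm z k x).trans_le (add_le_add_left ?_ _)
  refine (Finset.sum_le_sum fun i _ => hM i).trans_eq ?_
  rw [← coe_sum_eq_sum_coe]
  simp [Nat.cast_pred Fintype.card_pos]

lemma exists_coe_le_sum_erase [Nonempty ι] (hK : ∀ x y, 0 ≤ K x y) {u : X → ℝ} {z : ι → X}
    (hz : ((∑ i, u (z i) : ℝ) : EReal) ≤ pairCost K z) :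
    ∃ k, (u (z k) : EReal) ≤ ∑ i ∈ Finset.univ.erase k, K (z k) (z i) :=
  exists_coe_le_of_coe_sum_le (hz.trans (pairCost_le_sum_sum_erase hK z))

lemma le_add_of_pairCost_lt_add [Nonempty ι] (hK : ∀ x y, 0 ≤ K x y)
    (hsymm : ∀ x y, K x y = K y x) {u : X → ℝ}
    (hu : ∀ x : ι → X, ((∑ i, u (x i) : ℝ) : EReal) ≤ pairCost K x) {z : ι → X} {δ : ℝ}
    (hz : pairCost K z < ((∑ i, u (z i) + δ : ℝ) : EReal)) {x : X} {M : ℝ}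
    (hM : ∀ i, K x (z i) ≤ M) : u x ≤ (Fintype.card ι - 1) * M + δ := by
  obtain ⟨k, hk⟩ := exists_coe_le_sum_erase hK (hu z)
  have htight : (u (z k) : EReal) + pairCostErase K z k < ((∑ i, u (z i) + δ : ℝ) : EReal) :=
    (add_le_add_left hk _).trans_lt (pairCost_eq_sum_erase_add hsymm z k ▸ hz)
  have hmoved := (hu _).trans (pairCost_update_le hsymm hM k)
  have hne_top : pairCostErase K z k ≠ ⊤ := fun h => by simp [h] at htight
  have hne_bot : pairCostErase K z k ≠ ⊥ :=
    (EReal.bot_lt_zero.trans_le (pairCostErase_nonneg hK z k)).ne'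
  lift pairCostErase K z k to ℝ using ⟨hne_top, hne_bot⟩ with r
  rw [← EReal.coe_add, EReal.coe_lt_coe_iff,
    ← Finset.add_sum_erase _ (fun i => u (z i)) (Finset.mem_univ k)] at htight
  rw [← EReal.coe_add, EReal.coe_le_coe_iff, sum_comp_update] at hmoved
  linarith

lemma IsDualMaximizer.le_mul [Nonempty ι] [MeasurableSpace X] {ρ : Measure X} [IsFiniteMeasure ρ]
    (hK : ∀ x y, 0 ≤ K x y) (hsymm : ∀ x y, K x y = K y x) {u : X → ℝ}
    (hu : IsDualMaximizer (pairCost K : (ι → X) → EReal) ρ u) {x : X} {M : ℝ}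
    (hM : Fintype.card ι * ρ.real {y | (M : EReal) < K x y} < ρ.real Set.univ) :
    u x ≤ (Fintype.card ι - 1) * M := by
  refine le_of_forall_pos_le_add fun δ hδ => ?_
  obtain ⟨z, hzM, hz⟩ := hu.exists_almost_tight hM hδ
  exact le_add_of_pairCost_lt_add hK hsymm hu.1.2 hz fun i => not_lt.1 (hzM i)

end PairCost

section Interaction

variable {φ : ℝ → ℝ}

lemma extend_nonneg (hφ : ∀ t, 0 < t → 0 ≤ φ t) (t : ℝ) : 0 ≤ extend φ t := by
  unfold extend
  split_ifs with ht
  · exact EReal.coe_nonneg.2 (hφ t ht)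
  · exact le_top

lemma extend_le_coe (hφ : AntitoneOn φ (Set.Ioi 0)) {β t : ℝ} (hβ : 0 < β) (hβt : β ≤ t) :
    extend φ t ≤ φ β := by
  have ht : 0 < t := hβ.trans_le hβt
  rw [extend, if_pos ht]
  exact EReal.coe_le_coe_iff.2 (hφ hβ ht hβt)

lemma setOf_lt_extend_dist_subset_ball {X : Type*} [PseudoMetricSpace X]
    (hφ : AntitoneOn φ (Set.Ioi 0)) {β : ℝ} (hβ : 0 < β) (x : X) :
    {y | (φ β : EReal) < extend φ (dist x y)} ⊆ Metric.ball x β := fun y hy => by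
  rw [Metric.mem_ball']
  contrapose! hy
  exact not_lt.2 (extend_le_coe hφ hβ hy)

lemma mem_image_Ioi_of_le (hcont : ContinuousOn φ (Set.Ioi 0)) (hlim : Tendsto φ (𝓝[>] 0) atTop)
    {β s : ℝ} (hβ : 0 < β) (hs : φ β ≤ s) : s ∈ φ '' Set.Ioi 0 := by
  obtain ⟨a, ⟨ha, haβ⟩, has⟩ :=
    (Filter.Eventually.and (Ioo_mem_nhdsGT hβ) (hlim.eventually_ge_atTop s)).exists
  have hIcc : Set.Icc a β ⊆ Set.Ioi 0 := fun t ht => ha.trans_le ht.1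
  exact Set.image_mono hIcc (intermediate_value_Icc' haβ.le (hcont.mono hIcc) ⟨hs, has⟩)

lemma inverse_le (hφ : StrictAntiOn φ (Set.Ioi 0)) {β s : ℝ} (hs : s ∈ φ '' Set.Ioi 0)
    (hβ : 0 < β) (hβs : φ β ≤ s) : inverse φ s ≤ β := by
  refine (hφ.le_iff_ge hβ (Function.invFunOn_mem hs)).1 ?_
  rwa [Function.invFunOn_eq hs]

lemma IsRepulsive.sq_mul_le_of_lt_inverse (hφ : IsRepulsive φ) {N : ℕ} (hN : 2 ≤ N) {α β : ℝ}
    (hβ : 0 < β) (hα : 0 < α) (hαβ : α < inverse φ ((N : ℝ) ^ 2 * ((N : ℝ) - 1) / 2 * φ β)) :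
    ((N : ℝ) - 1) ^ 2 * φ β ≤ (N : ℝ) * ((N : ℝ) - 1) ^ 2 * φ (α / 2) := by
  have hN' : (2 : ℝ) ≤ N := Nat.ofNat_le_cast.2 hN
  have hφβ : 0 ≤ φ β := hφ.nonneg β hβ
  have hs : φ β ≤ (N : ℝ) ^ 2 * ((N : ℝ) - 1) / 2 * φ β :=
    le_mul_of_one_le_left hφβ (by nlinarith)
  have hαβ' : α < β := hαβ.trans_le <|
    inverse_le hφ.strictAntiOn (mem_image_Ioi_of_le hφ.continuousOn hφ.tendsto_zero hβ hs) hβ hs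
  have hφα : φ β ≤ φ (α / 2) := hφ.strictAntiOn.antitoneOn (half_pos hα) hβ (by linarith)
  refine mul_le_mul (le_mul_of_one_le_left (sq_nonneg _) (by linarith)) hφα hφβ (by positivity)

end Interaction

section Concentration

variable {d N : ℕ} {ρ : Measure (EuclideanSpace ℝ (Fin d))}

lemma real_ball_le_concentration (ρ : Measure (EuclideanSpace ℝ (Fin d))) [IsFiniteMeasure ρ]
    (x : EuclideanSpace ℝ (Fin d)) (r : ℝ) : ρ.real (Metric.ball x r) ≤ concentration ρ r :=
  le_ciSup (f := fun x => ρ.real (Metric.ball x r))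
    ⟨ρ.real Set.univ, Set.forall_mem_range.2 fun _ => measureReal_mono (Set.subset_univ _)⟩ x

lemma mul_real_setOf_lt_extend_dist_lt_real_univ [IsProbabilityMeasure ρ] (hN : 2 ≤ N) {φ : ℝ → ℝ}
    (hφ : AntitoneOn φ (Set.Ioi 0)) {β : ℝ} (hβ : 0 < β)
    (hρ : concentration ρ β < 1 / ((N : ℝ) * ((N : ℝ) - 1) ^ 2)) (x : EuclideanSpace ℝ (Fin d)) :
    N * ρ.real {y | (φ β : EReal) < extend φ (dist x y)} < ρ.real Set.univ := by
  have hN' : (2 : ℝ) ≤ N := Nat.ofNat_le_cast.2 hN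
  rw [probReal_univ, mul_comm, ← lt_div_iff₀ (by linarith)]
  calc ρ.real {y | (φ β : EReal) < extend φ (dist x y)}
      ≤ ρ.real (Metric.ball x β) := measureReal_mono (setOf_lt_extend_dist_subset_ball hφ hβ x)
    _ ≤ concentration ρ β := real_ball_le_concentration ρ x β
    _ < 1 / ((N : ℝ) * ((N : ℝ) - 1) ^ 2) := hρ
    _ ≤ 1 / N := one_div_le_one_div_of_le (by linarith) (by nlinarith)

lemma IsKantorovichPotential.isDualMaximizer {φ : ℝ → ℝ} (hN : 0 < N)
    {u : EuclideanSpace ℝ (Fin d) → ℝ} (hu : IsKantorovichPotential φ N ρ u) :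
    IsDualMaximizer (ι := Fin N) (pairCost fun x y => extend φ (dist x y)) ρ u := by
  refine ⟨hu.1, fun v hv => ?_⟩
  have hle : (N : ℝ) * ∫ x, v x ∂ρ ≤ N * ∫ x, u x ∂ρ := hu.2 hv
  exact le_of_mul_le_mul_left hle (Nat.cast_pos.2 hN)

end Concentration

lemma abs_le_sq_mul_of_neg_le_of_le {n : ℕ} {t M : ℝ} (hlow : -(n * (n * M)) ≤ t)
    (hup : t ≤ n * M) : |t| ≤ (n : ℝ) ^ 2 * M := by
  obtain rfl | hn := n.eq_zero_or_pos
  · exact abs_le.2 ⟨by simpa using hlow, by simpa using hup⟩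
  have hn' : (1 : ℝ) ≤ n := Nat.one_le_cast.2 hn
  have hM : 0 ≤ n * M := by nlinarith
  have hsq : n * M ≤ n * (n * M) := le_mul_of_one_le_left hM hn'
  rw [pow_two, mul_assoc]
  exact abs_le.2 ⟨hlow, hup.trans hsq⟩

end RepulsiveOT

open RepulsiveOT in
theorem mainTheorem4_general {X : Type*} [MeasurableSpace X] {ρ : Measure X} [IsFiniteMeasure ρ]
    {K : X → X → EReal} (hK : ∀ x y, 0 ≤ K x y) (hsymm : ∀ x y, K x y = K y x)
    {N : ℕ} (hN : 0 < N) {u : X → ℝ}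
    (hu : IsDualMaximizer (pairCost K : (Fin N → X) → EReal) ρ u)
    (hconj : ∀ x, conjugate (n := N - 1) (pairCost K) u x ≤ u x) {M : ℝ}
    (hM : ∀ x, N * ρ.real {y | (M : EReal) < K x y} < ρ.real Set.univ) (x : X) :
    |u x| ≤ ((N : ℝ) - 1) ^ 2 * M := by
  have : Nonempty (Fin N) := Fin.pos_iff_nonempty.1 hN
  have hup : ∀ y, u y ≤ ((N - 1 : ℕ) : ℝ) * M := fun y => by
    simpa [Nat.cast_pred hN] using hu.le_mul hK hsymm (x := y) (by simpa using hM y)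
  have hlow : -(((N - 1 : ℕ) : ℝ) * (((N - 1 : ℕ) : ℝ) * M)) ≤ u x :=
    EReal.coe_le_coe_iff.1 ((neg_mul_le_conjugate (pairCost_nonneg hK) hup x).trans (hconj x))
  simpa only [Nat.cast_pred hN] using abs_le_sq_mul_of_neg_le_of_le hlow (hup x)

theorem mainTheorem4 (d N : ℕ) (hN : 2 ≤ N) (φ : ℝ → ℝ) (hφ : RepulsiveOT.IsRepulsive φ)
    (ρ : MeasureTheory.Measure (EuclideanSpace ℝ (Fin d)))
    [MeasureTheory.IsProbabilityMeasure ρ]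
    (hA : RepulsiveOT.SmallConcentration N ρ)
    (u : EuclideanSpace ℝ (Fin d) → ℝ)
    (hu : RepulsiveOT.IsKantorovichPotential φ N ρ u)
    (hconj : ∀ x, (u x : EReal) = RepulsiveOT.cConjugate φ N u x)
    (β : ℝ) (hβ : 0 < β)
    (hβρ : RepulsiveOT.concentration ρ β < 1 / ((N : ℝ) * ((N : ℝ) - 1) ^ 2))
    (α : ℝ) (hα : 0 < α)
    (hαβ : α < RepulsiveOT.inverse φ ((N : ℝ) ^ 2 * ((N : ℝ) - 1) / 2 * φ β)) :
    ∀ x, |u x| ≤ (N : ℝ) * ((N : ℝ) - 1) ^ 2 * φ (α / 2) := by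
  exact fun x => (mainTheorem4_general (fun _ _ => RepulsiveOT.extend_nonneg hφ.nonneg _)
    (fun _ _ => by rw [dist_comm]) (by omega) (hu.isDualMaximizer (by omega))
    (fun y => (hconj y).ge) (RepulsiveOT.mul_real_setOf_lt_extend_dist_lt_real_univ hN
      hφ.strictAntiOn.antitoneOn hβ hβρ) x).trans (hφ.sq_mul_le_of_lt_inverse hN hβ hα hαβ)
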